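/- A lattice path is a finite sequence of unit north steps $(0,1)$ and east steps $(1,0)$ in the plane that starts at a lattice point. Let $u,v,c,d$ be integers with $u,c,d\ge 0$ and $v-c\ge d$. Set $s_i=(-i,i)$ for $0\le i\le d$ and $t_j=(u+c-j,\,v-c+j)$ for $0\le j\le c$, and write $s_P=s_0=(0,0)$, $s_Q=s_d=(-d,d)$, $t_P=t_0=(u+c,v-c)$, $t_Q=t_c=(u,v)$. Let $P$ be a lattice path from $s_P$ to $t_P$ and $Q$ a lattice path from $s_Q$ to $t_Q$ such that $P$ never crosses above $Q$ (for $0\le k\le u+v$, the point of $P$ on the line $x+y=k$ is not higher than the point of $Q$ on that line). Let $\mathcal R$ be the region bounded by $P$, $Q$, the line through $s_P$ and $s_Q$ (that is, $x+y=0$), and the line through $t_P$ and $t_Q$ (that is, $x+y=u+v$). Label each north step by the sum of the coordinates of its higher endpoint, let $E=\{1,2,\ldots,u+v\}$, and for a lattice path $P'$ in $\mathcal R$ let $b(P')\subseteq E$ be the set of labels on its north steps. Let $\mathcal P$ be the set of lattice paths from some $s_i$ to some $t_j$ that remain in $\mathcal R$. Let $M(\mathcal R_{\min})$ be the matroid on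 $E$ whose bases are the sets $b(P')$ for $P'\in\mathcal P$ going from $s_Q$ to $t_P$, and let $M(\mathcal R_{\max})$ be the matroid on $E$ whose bases are the sets $b(P')$ for $P'\in\mathcal P$ going from $s_P$ to $t_Q$. A matroid $M'$ on $E$ is a quotient of a matroid $L$ on $E$ if there are a matroid $N$ and a subset $X$ of $E(N)$ with $N\backslash X=L$ and $N/X=M'$. In that case, for $0\le i\le r(L)-r(M')$, the $i$-th Higgs lift $H^i$ of $M'$ toward $L$ is the matroid on $E$ with rank function $X\mapsto\min\{r_{M'}(X)+i,\,r_L(X)\}$, and the full Higgs lift delta-matroid of the pair $(M',L)$ is the delta-matroid on $E$ whose feasible sets are the bases of the matroids $H^0,H^1,\ldots,H^{r(L)-r(M')}$. Then: 1. $M(\mathcal R_{\min})$ is a quotient of $M(\mathcal R_{\max})$, and 2. the map $P'\mapsto b(P')$ is a surjection from $\mathcal P$ onto the set of feasible sets of the full Higgs lift delta-matroid of the pair $(M(\mathcal R_{\min}),M(\mathcal R_{\max}))$. -/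

import Mathlib

/-! ### Quotients, Higgs lifts, delta-matroids -/

/-- `Q` is a quotient of `L` (both on the same finite ground set `E`): there are a finite matroid `N`
and a subset `X` of `E(N)` with `N ＼ X = L` and `N ／ X = Q`.  The elements of `N` outside `X`
are tagged `Sum.inl`, those in `X` are tagged `Sum.inr`. -/
def Matroid.IsQuotientOf {α : Type*} (Q L : Matroid α) : Prop :=
  ∃ (β : Type) (N : Matroid (α ⊕ β)), N.Finite ∧
    N.delete (Set.range Sum.inr) = L.mapEmbedding Function.Embedding.inl ∧
    N.contract (Set.range Sum.inr) = Q.mapEmbedding Function.Embedding.inl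

theorem Matroid.IsQuotientOf.ground_eq {α : Type*} {Q L : Matroid α} (h : Q.IsQuotientOf L) :
    Q.E = L.E := by
  obtain ⟨β, N, -, hL, hQ⟩ := h
  have h1 := congrArg Matroid.E hL
  have h2 := congrArg Matroid.E hQ
  simp only [Matroid.delete_ground, Matroid.contract_ground, Matroid.mapEmbedding_ground_eq] at h1 h2
  exact Function.Embedding.inl.injective.image_injective (h2.symm.trans h1)

theorem Matroid.IsQuotientOf.finite {α : Type*} {Q L : Matroid α} (h : Q.IsQuotientOf L) :
    L.E.Finite := by
  obtain ⟨β, N, hN, hL, -⟩ := h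
  have h1 := congrArg Matroid.E hL
  simp only [Matroid.delete_ground, Matroid.mapEmbedding_ground_eq] at h1
  have h2 : (Function.Embedding.inl '' L.E : Set (α ⊕ β)).Finite := by
    rw [← h1]; exact hN.ground_finite.subset Set.sdiff_subset
  exact Set.Finite.of_finite_image h2 Function.Embedding.inl.injective.injOn

theorem Matroid.IsQuotientOf.closure_subset {α : Type*} {Q L : Matroid α} (h : Q.IsQuotientOf L)
    (X : Set α) : L.closure X ⊆ Q.closure X := by
  obtain ⟨β, N, -, hL, hQ⟩ := h
  intro e he
  have key (M : Matroid α) : Sum.inl e ∈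
      (M.mapEmbedding (Function.Embedding.inl : α ↪ α ⊕ β)).closure (Sum.inl '' X) ↔
      e ∈ M.closure X := by
    rw [Matroid.mapEmbedding, Matroid.map_closure_eq]
    have : (Function.Embedding.inl : α ↪ α ⊕ β) ⁻¹' (Sum.inl '' X) = X :=
      Set.preimage_image_eq X Function.Embedding.inl.injective
    rw [this]
    exact Function.Embedding.inl.injective.mem_set_image
  rw [← key, ← hQ, Matroid.contract_closure_eq]
  rw [← key, ← hL, Matroid.delete_closure_eq] at he
  exact ⟨N.closure_subset_closure (Set.sdiff_subset.trans Set.subset_union_left) he.1, he.2⟩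

/-- In the notation `r_i(X) = min {r_Q(X) + i, r_L(X)}`, the condition `r_i(I) = |I|` says that `I`
is independent in `L` and has nullity at most `i` in `Q`. -/
theorem Matroid.higgs_indep_iff {α : Type*} {Q L : Matroid α} (h : Q.IsQuotientOf L) (i : ℕ)
    (I : Set α) :
    (I ⊆ L.E ∧ min (Q.eRk I + i) (L.eRk I) = I.encard) ↔ L.Indep I ∧ I.encard ≤ Q.eRk I + i := by
  constructor
  · rintro ⟨hI, hr⟩
    have hfin := h.finite.subset hI
    refine ⟨(Matroid.indep_iff_eRk_eq_encard_of_finite hfin).2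
      (le_antisymm (L.eRk_le_encard I) (hr ▸ min_le_right _ _)), hr ▸ min_le_left _ _⟩
  · rintro ⟨hI, hr⟩
    exact ⟨hI.subset_ground, by rw [hI.eRk_eq_encard, min_eq_right hr]⟩

/-- The `i`-th Higgs lift of `Q` toward `L`, where `Q` is a quotient of `L`: the matroid on `E` whose
rank function is `r_i(X) = min {r_Q(X) + i, r_L(X)}`, that is, whose independent sets are the
`I ⊆ E` with `r_i(I) = |I|`. -/
noncomputable def Matroid.higgsLift {α : Type*} (Q L : Matroid α) (h : Q.IsQuotientOf L) (i : ℕ) :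
    Matroid α :=
  (IndepMatroid.ofFinite h.finite
    (fun I => I ⊆ L.E ∧ min (Q.eRk I + i) (L.eRk I) = I.encard)
    ⟨Set.empty_subset _, by simp⟩
    (by
      intro I J hJ hIJ
      rw [Matroid.higgs_indep_iff h] at hJ ⊢
      refine ⟨hJ.1.subset hIJ, ?_⟩
      have hfin := h.finite.subset hJ.1.subset_ground
      have h1 : Q.eRk J ≤ (J \ I).encard + Q.eRk I := by
        calc Q.eRk J = Q.eRk ((J \ I) ∪ I) := by rw [Set.sdiff_union_of_subset hIJ]
          _ ≤ _ := Q.eRk_union_le_encard_add_eRk _ _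
      have h2 : (J \ I).encard + I.encard = J.encard := Set.encard_sdiff_add_encard_of_subset hIJ
      have h3 : (J \ I).encard ≠ ⊤ := (Set.encard_lt_top_iff.2 (hfin.subset Set.sdiff_subset)).ne
      have h4 : (J \ I).encard + I.encard ≤ (J \ I).encard + (Q.eRk I + i) := by
        rw [h2, ← add_assoc]
        exact hJ.2.trans (by gcongr)
      exact (ENat.add_le_add_iff_left h3).1 h4)
    (by
      intro I J hI hJ hIJ
      simp only [Matroid.higgs_indep_iff h] at hI hJ ⊢
      have hIf := h.finite.subset hI.1.subset_ground
      have hJf := h.finite.subset hJ.1.subset_ground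
      have hlt : I.encard < J.encard := by
        rw [← hIf.cast_ncard_eq, ← hJf.cast_ncard_eq]; exact_mod_cast hIJ
      by_contra! hcon
      have hItop : I.encard ≠ ⊤ := (Set.encard_lt_top_iff.2 hIf).ne
      by_cases hn : I.encard < Q.eRk I + i
      · obtain ⟨e, he, hind⟩ := hI.1.augment hJ.1 hlt
        refine absurd (hcon e he.1 he.2 hind) (not_lt.2 ?_)
        rw [Set.encard_insert_of_notMem he.2]
        refine (Order.add_one_le_of_lt hn).trans ?_
        gcongr
        exact Q.eRk_mono (Set.subset_insert e I)
      · have hn' : Q.eRk I + i ≤ I.encard := not_lt.1 hn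
        have hsub : J ⊆ Q.closure I := by
          intro e heJ
          have heE : e ∈ Q.E := h.ground_eq ▸ hJ.1.subset_ground heJ
          by_cases heI : e ∈ I
          · exact Q.mem_closure_of_mem' heI heE
          by_cases heL : L.Indep (insert e I)
          · by_contra hcl
            have := hcon e heJ heI heL
            rw [Matroid.eRk_insert_eq_add_one ⟨heE, hcl⟩, Set.encard_insert_of_notMem heI,
              add_right_comm] at this
            exact absurd (add_le_add_left hI.2 1) (not_le.2 this)
          · refine h.closure_subset I ?_
            by_contra hcl
            exact heL ((hI.1.notMem_closure_iff_of_notMem heI (h.ground_eq ▸ heE)).1 hcl)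
        have h1 : Q.eRk J ≤ Q.eRk I := by
          rw [← Q.eRk_closure_eq I]; exact Q.eRk_mono hsub
        have h2 : J.encard ≤ I.encard := hJ.2.trans (le_trans (by gcongr) hn')
        exact absurd hlt (not_lt.2 h2))
    (fun _ hI => hI.1)).matroid

theorem Matroid.higgsLift_indep_iff {α : Type*} {Q L : Matroid α} (h : Q.IsQuotientOf L) (i : ℕ)
    (I : Set α) :
    (Q.higgsLift L h i).Indep I ↔ L.Indep I ∧ I.encard ≤ Q.eRk I + i :=
  Matroid.higgs_indep_iff h i I

theorem Matroid.higgsLift_ground {α : Type*} {Q L : Matroid α} (h : Q.IsQuotientOf L) (i : ℕ) :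
    (Q.higgsLift L h i).E = L.E := rfl

/-- The rank function of the Higgs lift is the expected one. -/
theorem Matroid.higgsLift_eRk {α : Type*} {Q L : Matroid α} (h : Q.IsQuotientOf L) (i : ℕ)
    (X : Set α) (hX : X ⊆ L.E) :
    (Q.higgsLift L h i).eRk X = min (Q.eRk X + i) (L.eRk X) := by
  obtain ⟨I, hI⟩ := (Q.higgsLift L h i).exists_isBasis X hX
  have hind := (Matroid.higgsLift_indep_iff h i I).1 hI.indep
  rw [← hI.encard_eq_eRk]
  refine le_antisymm (le_min (hind.2.trans ?_) ?_) ?_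
  · gcongr; exact Q.eRk_mono hI.subset
  · exact hind.1.encard_le_eRk_of_subset hI.subset
  have hmax : ∀ e ∈ X, e ∉ I → ¬ (Q.higgsLift L h i).Indep (insert e I) := fun e he heI hi =>
    heI (hI.mem_of_insert_indep he hi)
  by_cases hn : I.encard < Q.eRk I + i
  · refine min_le_of_right_le ?_
    rw [← hind.1.eRk_eq_encard, ← L.eRk_closure_eq I]
    refine L.eRk_mono fun e he => ?_
    by_cases heI : e ∈ I
    · exact L.mem_closure_of_mem' heI (hX he)
    by_contra hcl
    refine hmax e he heI ((Matroid.higgsLift_indep_iff h i _).2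
      ⟨(hind.1.notMem_closure_iff_of_notMem heI (hX he)).1 hcl, ?_⟩)
    rw [Set.encard_insert_of_notMem heI]
    refine (Order.add_one_le_of_lt hn).trans ?_
    gcongr
    exact Q.eRk_mono (Set.subset_insert e I)
  · refine min_le_of_left_le (le_trans ?_ (not_lt.1 hn))
    gcongr
    rw [← Q.eRk_closure_eq I]
    refine Q.eRk_mono fun e he => ?_
    have heE : e ∈ Q.E := h.ground_eq ▸ hX he
    by_cases heI : e ∈ I
    · exact Q.mem_closure_of_mem' heI heE
    by_contra hcl
    have hclL : e ∉ L.closure I := fun h' => hcl (h.closure_subset I h')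
    refine hmax e he heI ((Matroid.higgsLift_indep_iff h i _).2
      ⟨(hind.1.notMem_closure_iff_of_notMem heI (hX he)).1 hclL, ?_⟩)
    rw [Matroid.eRk_insert_eq_add_one ⟨heE, hcl⟩, Set.encard_insert_of_notMem heI,
      add_right_comm]
    exact add_le_add_left hind.2 1

/-- A delta-matroid: a finite ground set with a non-empty family of feasible subsets that satisfies
the symmetric exchange axiom. -/
structure DeltaMatroid (α : Type*) where
  E : Set α
  Feasible : Set α → Prop
  ground_finite : E.Finite
  exists_feasible : ∃ F, Feasible F
  subset_ground : ∀ F, Feasible F → F ⊆ E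
  symm_exchange : ∀ X Y, Feasible X → Feasible Y → ∀ u ∈ symmDiff X Y,
    ∃ v ∈ symmDiff X Y, Feasible (symmDiff X {u, v})

/-- The family of the sets that are bases of some Higgs lift `H^i` of `Q` toward `L`,
`0 ≤ i ≤ r(L) - r(Q)`. -/
def Matroid.IsHiggsFeasible {α : Type*} (Q L : Matroid α) (h : Q.IsQuotientOf L) (F : Set α) : Prop :=
  ∃ i : ℕ, Q.eRank + i ≤ L.eRank ∧ (Q.higgsLift L h i).IsBase F

theorem Matroid.isHiggsFeasible_iff {α : Type*} {Q L : Matroid α} (h : Q.IsQuotientOf L)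
    (F : Set α) : Q.IsHiggsFeasible L h F ↔ L.Indep F ∧ Q.Spanning F := by
  have : L.Finite := ⟨h.finite⟩
  have : Q.Finite := ⟨h.ground_eq ▸ h.finite⟩
  constructor
  · rintro ⟨i, hi, hB⟩
    have hind := (Matroid.higgsLift_indep_iff h i F).1 hB.indep
    refine ⟨hind.1, ?_⟩
    have hFE : F ⊆ Q.E := h.ground_eq ▸ hind.1.subset_ground
    rw [Matroid.spanning_iff_eRk_le hFE]
    have h1 : F.encard = Q.eRank + i := by
      rw [hB.encard_eq_eRank, Matroid.eRank_def, Matroid.higgsLift_ground,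
        Matroid.higgsLift_eRk h i _ subset_rfl, ← L.eRank_def, ← h.ground_eq, ← Q.eRank_def,
        min_eq_left hi]
    rw [h1] at hind
    exact (ENat.add_le_add_iff_right (ENat.natCast_ne_top i)).1 hind.2
  · rintro ⟨hI, hS⟩
    have hfin : F.Finite := h.finite.subset hI.subset_ground
    have hle : Q.eRank ≤ F.encard := hS.eRk_eq ▸ Q.eRk_le_encard F
    obtain ⟨i, hi⟩ : ∃ i : ℕ, Q.eRank + i = F.encard := by
      obtain ⟨j, hj⟩ := exists_add_of_le hle
      have : j ≠ ⊤ := by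
        rintro rfl
        rw [add_top] at hj
        exact (Set.encard_lt_top_iff.2 hfin).ne hj
      exact ⟨j.toNat, by rw [ENat.natCast_toNat this, hj]⟩
    refine ⟨i, hi ▸ hI.encard_le_eRank, ?_⟩
    have hind : (Q.higgsLift L h i).Indep F := (Matroid.higgsLift_indep_iff h i F).2
      ⟨hI, by rw [hS.eRk_eq, hi]⟩
    refine hind.isBase_of_eRk_ge hfin ?_
    rw [hind.eRk_eq_encard, ← hi, Matroid.eRank_def, Matroid.higgsLift_ground,
      Matroid.higgsLift_eRk h i _ subset_rfl]
    conv_lhs => rw [← h.ground_eq, ← Q.eRank_def]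
    exact min_le_left _ _

/-- The full Higgs lift delta-matroid of the pair `(Q, L)`, where `Q` is a quotient of `L`: its
feasible sets are the bases of all Higgs lifts `H^i` of `Q` toward `L`, `0 ≤ i ≤ r(L) - r(Q)`. -/
def Matroid.fullHiggsLift {α : Type*} (Q L : Matroid α) (h : Q.IsQuotientOf L) :
    DeltaMatroid α where
  E := L.E
  Feasible := Q.IsHiggsFeasible L h
  ground_finite := h.finite
  exists_feasible := by
    obtain ⟨B, hB⟩ := L.exists_isBase
    refine ⟨B, (Matroid.isHiggsFeasible_iff h B).2 ⟨hB.indep, ?_⟩⟩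
    have hBE : B ⊆ Q.E := h.ground_eq ▸ hB.subset_ground
    rw [Matroid.spanning_iff_ground_subset_closure hBE, h.ground_eq, ← hB.closure_eq]
    exact h.closure_subset B
  subset_ground := fun F hF => ((Matroid.isHiggsFeasible_iff h F).1 hF).1.subset_ground
  symm_exchange := by
    intro X Y hX hY u hu
    simp only [Matroid.isHiggsFeasible_iff] at hX hY ⊢
    have hXE : X ⊆ Q.E := hX.2.subset_ground
    have hYE : Y ⊆ Q.E := hY.2.subset_ground
    rcases hu with ⟨huX, huY⟩ | ⟨huY, huX⟩
    · by_cases hsp : Q.Spanning (X \ {u})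
      · refine ⟨u, Or.inl ⟨huX, huY⟩, ?_⟩
        have : symmDiff X {u, u} = X \ {u} := by
          ext x; simp [Set.mem_symmDiff]; grind
        rw [this]
        exact ⟨hX.1.subset Set.sdiff_subset, hsp⟩
      · have hnot : ¬ Y ⊆ Q.closure (X \ {u}) := by
          intro hYs
          refine hsp ((Matroid.spanning_iff_ground_subset_closure
            (Set.sdiff_subset.trans hXE)).2 ?_)
          rw [← hY.2.closure_eq]
          exact Q.closure_subset_closure_of_subset_closure hYs
        obtain ⟨v, hvY, hv⟩ := Set.not_subset.1 hnot
        have hvX : v ∉ X := by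
          intro hvX
          refine hv (Q.mem_closure_of_mem' ⟨hvX, ?_⟩ (hYE hvY))
          rintro rfl
          exact huY hvY
        refine ⟨v, Or.inr ⟨hvY, hvX⟩, ?_⟩
        have : symmDiff X {u, v} = insert v (X \ {u}) := by
          ext x; simp [Set.mem_symmDiff]; grind
        rw [this]
        constructor
        · have hi : L.Indep (X \ {u}) := hX.1.subset Set.sdiff_subset
          exact (hi.notMem_closure_iff_of_notMem (fun hc => hvX hc.1)
            (h.ground_eq ▸ hYE hvY)).1 fun hc => hv (h.closure_subset _ hc)
        · have huc : u ∈ Q.closure (insert v (X \ {u})) := by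
            refine (Q.closure_exchange (e := v) ⟨?_, hv⟩).1
            rw [Set.insert_sdiff_singleton, Set.insert_eq_of_mem huX, hX.2.closure_eq]
            exact hYE hvY
          refine (Matroid.spanning_iff_ground_subset_closure
            (Set.insert_subset (hYE hvY) (Set.sdiff_subset.trans hXE))).2 ?_
          rw [← hX.2.closure_eq]
          refine Q.closure_subset_closure_of_subset_closure fun x hx => ?_
          by_cases hxu : x = u
          · exact hxu ▸ huc
          · exact Q.mem_closure_of_mem' (Or.inr ⟨hx, hxu⟩) (hXE hx)
    · by_cases hin : L.Indep (insert u X)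
      · refine ⟨u, Or.inr ⟨huY, huX⟩, ?_⟩
        have : symmDiff X {u, u} = insert u X := by
          ext x; simp [Set.mem_symmDiff]; grind
        rw [this]
        exact ⟨hin, hX.2.superset (Set.subset_insert u X) (Set.insert_subset (hYE huY) hXE)⟩
      · have huc : u ∈ L.closure X := by
          by_contra hc
          exact hin ((hX.1.notMem_closure_iff_of_notMem huX (h.ground_eq ▸ hYE huY)).1 hc)
        have hC := hX.1.fundCircuit_isCircuit huc huX
        obtain ⟨v, hvC, hvY⟩ : ∃ v ∈ L.fundCircuit u X, v ∉ Y := by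
          by_contra! hc
          exact hC.not_indep (hY.1.subset hc)
        have hvu : v ≠ u := fun e => hvY (e ▸ huY)
        have hvX : v ∈ X := (L.fundCircuit_subset_insert u X hvC).resolve_left hvu
        refine ⟨v, Or.inl ⟨hvX, hvY⟩, ?_⟩
        have : symmDiff X {u, v} = insert u X \ {v} := by
          ext x; simp [Set.mem_symmDiff]; grind
        rw [this]
        have hvc : v ∈ L.closure (insert u X \ {v}) :=
          L.closure_subset_closure (Set.sdiff_subset_sdiff_left (L.fundCircuit_subset_insert u X))
            (hC.mem_closure_sdiff_singleton_of_mem hvC)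
        refine ⟨?_, ?_⟩
        · exact (hX.1.mem_fundCircuit_iff huc huX).1 hvC
        · refine (Matroid.spanning_iff_ground_subset_closure
            (Set.sdiff_subset.trans (Set.insert_subset (hYE huY) hXE))).2 ?_
          rw [← hX.2.closure_eq]
          refine Q.closure_subset_closure_of_subset_closure fun x hx => ?_
          by_cases hxv : x = v
          · rw [hxv]; exact h.closure_subset _ hvc
          · exact Q.mem_closure_of_mem' ⟨Or.inr hx, hxv⟩ (hXE hx)

/-! ### Lattice paths -/

/-- The two kinds of unit steps. -/
inductive LatticeStep where
  | east : LatticeStep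
  | north : LatticeStep

/-- The displacement of a step. -/
def LatticeStep.vec : LatticeStep → ℤ × ℤ
  | .east => (1, 0)
  | .north => (0, 1)

/-- A lattice path: a starting lattice point and a finite sequence of unit east and north steps. -/
structure LatticePath where
  start : ℤ × ℤ
  steps : List LatticeStep

/-- The point that the path has reached after its first `k` steps. -/
def LatticePath.point (w : LatticePath) (k : ℕ) : ℤ × ℤ :=
  w.start + ((w.steps.take k).map LatticeStep.vec).sum

/-- The end point of the path. -/
def LatticePath.finish (w : LatticePath) : ℤ × ℤ := w.point w.steps.length

/-- `b(w)`: the set of labels on the north steps of `w`, where a north step is labelled by the sum of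
the coordinates of its higher endpoint. -/
def LatticePath.northLabels (w : LatticePath) : Set ℤ :=
  {l | ∃ k : ℕ, w.steps[k]? = some LatticeStep.north ∧
    l = (w.point (k + 1)).1 + (w.point (k + 1)).2}

/-- The data of a region: integers `u, v, c, d` with `u, c, d ≥ 0` and `v - c ≥ d`, a lattice path `P`
from `s_P = (0, 0)` to `t_P = (u + c, v - c)` and a lattice path `Q` from `s_Q = (-d, d)` to
`t_Q = (u, v)`, with `P` never rising above `Q`.  After `k` steps both paths are on the line
`x + y = k`, so the last condition compares heights along these lines. -/
structure LatticeRegion where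
  u : ℕ
  v : ℕ
  c : ℕ
  d : ℕ
  le_v : c + d ≤ v
  P : LatticePath
  Q : LatticePath
  P_start : P.start = (0, 0)
  P_finish : P.finish = ((u : ℤ) + c, (v : ℤ) - c)
  Q_start : Q.start = (-(d : ℤ), (d : ℤ))
  Q_finish : Q.finish = ((u : ℤ), (v : ℤ))
  P_below_Q : ∀ k ≤ u + v, (P.point k).2 ≤ (Q.point k).2

/-- The lattice points of the region bounded by `P`, `Q` and the lines `x + y = 0` and
`x + y = u + v`: those on a line `x + y = k`, `0 ≤ k ≤ u + v`, that lie between the points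
of `P` and `Q` on that line. -/
def LatticeRegion.points (R : LatticeRegion) : Set (ℤ × ℤ) :=
  {z | ∃ k ≤ R.u + R.v, z.1 + z.2 = (k : ℤ) ∧ (R.P.point k).2 ≤ z.2 ∧ z.2 ≤ (R.Q.point k).2}

/-- The lattice paths from `a` to `b` that remain in the region. -/
def LatticeRegion.pathsBetween (R : LatticeRegion) (a b : ℤ × ℤ) : Set LatticePath :=
  {w | w.start = a ∧ w.finish = b ∧ ∀ k ≤ w.steps.length, w.point k ∈ R.points}

/-- The lattice points `s_0 = s_P, s_1, …, s_d = s_Q`. -/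
def LatticeRegion.s (_R : LatticeRegion) (i : ℕ) : ℤ × ℤ := (-(i : ℤ), (i : ℤ))

/-- The lattice points `t_0 = t_P, t_1, …, t_c = t_Q`. -/
def LatticeRegion.t (R : LatticeRegion) (j : ℕ) : ℤ × ℤ :=
  ((R.u : ℤ) + R.c - j, (R.v : ℤ) - R.c + j)

/-- The set of all lattice paths from some `s_i` to some `t_j` that remain in the region. -/
def LatticeRegion.paths (R : LatticeRegion) : Set LatticePath :=
  {w | ∃ i ≤ R.d, ∃ j ≤ R.c, w ∈ R.pathsBetween (R.s i) (R.t j)}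

/-- The ground set `{1, 2, …, u + v}` of all labels. -/
def LatticeRegion.labels (R : LatticeRegion) : Set ℤ := Set.Icc 1 ((R.u : ℤ) + R.v)

/-! Facts that show that the sets `b(w)`, over the paths `w` in the region between two fixed
end points, are the bases of a matroid. -/

theorem LatticePath.point_zero (w : LatticePath) : w.point 0 = w.start := by
  simp [LatticePath.point]

theorem LatticePath.point_succ (w : LatticePath) (k : ℕ) (hk : k < w.steps.length) :
    w.point (k + 1) = w.point k + (w.steps[k]).vec := by
  rw [LatticePath.point, LatticePath.point, List.take_add_one, List.getElem?_eq_getElem hk]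
  simp only [Option.toList_some, List.map_append, List.sum_append, List.map_cons, List.map_nil,
    List.sum_cons, List.sum_nil, add_zero, add_assoc]

theorem LatticePath.point_sum (w : LatticePath) (k : ℕ) (hk : k ≤ w.steps.length) :
    (w.point k).1 + (w.point k).2 = w.start.1 + w.start.2 + k := by
  induction k with
  | zero => simp [LatticePath.point_zero]
  | succ k ih =>
    rw [w.point_succ k hk]
    have := ih (by omega)
    rcases h : w.steps[k] <;> simp [LatticeStep.vec] <;> linarith

theorem LatticePath.height_step (w : LatticePath) (k : ℕ) (hk : k < w.steps.length) :
    (w.point (k + 1)).2 = (w.point k).2 ∨ (w.point (k + 1)).2 = (w.point k).2 + 1 := by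
  rw [w.point_succ k hk]
  rcases h : w.steps[k] <;> simp [LatticeStep.vec]

theorem LatticePath.mem_northLabels (w : LatticePath) (hs : w.start.1 + w.start.2 = 0) (l : ℤ) :
    l ∈ w.northLabels ↔ ∃ k < w.steps.length, (w.point (k + 1)).2 = (w.point k).2 + 1 ∧
      l = (k : ℤ) + 1 := by
  constructor
  · rintro ⟨k, hk, rfl⟩
    obtain ⟨hk', hN⟩ := List.getElem?_eq_some_iff.1 hk
    refine ⟨k, hk', ?_, ?_⟩
    · rw [w.point_succ k hk', hN]; simp [LatticeStep.vec]
    · rw [w.point_sum (k + 1) hk', hs]; push_cast; ring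
  · rintro ⟨k, hk, hN, rfl⟩
    refine ⟨k, ?_, ?_⟩
    · rw [List.getElem?_eq_some_iff]
      refine ⟨hk, ?_⟩
      rw [w.point_succ k hk] at hN
      rcases h : w.steps[k] with _ | _
      · rw [h] at hN; simp [LatticeStep.vec] at hN
      · rfl
    · rw [w.point_sum (k + 1) hk, hs]; push_cast; ring

/-- A path with prescribed heights. -/
theorem LatticePath.exists_of_heights (n : ℕ) (g : ℕ → ℤ)
    (hg : ∀ k < n, g (k + 1) = g k ∨ g (k + 1) = g k + 1) :
    ∃ w : LatticePath, w.start = (-g 0, g 0) ∧ w.steps.length = n ∧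
      ∀ k ≤ n, w.point k = ((k : ℤ) - g k, g k) := by
  classical
  let w : LatticePath := ⟨(-g 0, g 0), (List.range n).map
    fun k => if g (k + 1) = g k + 1 then LatticeStep.north else LatticeStep.east⟩
  have hlen : w.steps.length = n := by simp [w]
  refine ⟨w, rfl, hlen, fun k => ?_⟩
  induction k with
  | zero => intro _; simp [LatticePath.point_zero, w]
  | succ k ih =>
    intro hk
    rw [w.point_succ k (by omega), ih (by omega)]
    have hst : w.steps[k]'(by omega) =
      if g (k + 1) = g k + 1 then LatticeStep.north else LatticeStep.east := by simp [w]
    rw [hst]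
    rcases hg k (by omega) with h | h
    · rw [if_neg (by omega)]
      ext <;> simp [LatticeStep.vec, h]
      ring
    · rw [if_pos h]
      ext <;> simp [LatticeStep.vec, h]

theorem LatticePath.heights_exchange (n : ℕ) (h₁ h₂ a b : ℕ → ℤ)
    (hs₁ : ∀ k < n, h₁ (k + 1) = h₁ k ∨ h₁ (k + 1) = h₁ k + 1)
    (hs₂ : ∀ k < n, h₂ (k + 1) = h₂ k ∨ h₂ (k + 1) = h₂ k + 1)
    (h0 : h₁ 0 = h₂ 0) (hn : h₁ n = h₂ n)
    (hb₁ : ∀ k ≤ n, a k ≤ h₁ k ∧ h₁ k ≤ b k) (hb₂ : ∀ k ≤ n, a k ≤ h₂ k ∧ h₂ k ≤ b k)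
    (e : ℕ) (he : e < n) (he₁ : h₁ (e + 1) = h₁ e + 1) (he₂ : h₂ (e + 1) = h₂ e) :
    ∃ f < n, h₂ (f + 1) = h₂ f + 1 ∧ h₁ (f + 1) = h₁ f ∧ ∃ g : ℕ → ℤ,
      (∀ k < n, g (k + 1) = g k ∨ g (k + 1) = g k + 1) ∧ g 0 = h₁ 0 ∧ g n = h₁ n ∧
      (∀ k ≤ n, a k ≤ g k ∧ g k ≤ b k) ∧
      (∀ k < n, g (k + 1) = g k + 1 ↔ (k = f ∨ (h₁ (k + 1) = h₁ k + 1 ∧ k ≠ e))) := by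
  suffices hf : ∃ f < n, h₂ (f + 1) = h₂ f + 1 ∧ h₁ (f + 1) = h₁ f ∧
      (∀ k, e < k → k ≤ f → h₂ k < h₁ k) ∧ (∀ k, f < k → k ≤ e → h₁ k < h₂ k) by
    obtain ⟨f, hfn, hf₂, hf₁, hr, hl⟩ := hf
    have hfe : f ≠ e := by rintro rfl; omega
    refine ⟨f, hfn, hf₂, hf₁,
      fun k => h₁ k - (if e < k then 1 else 0) + (if f < k then 1 else 0), ?_, ?_, ?_, ?_, ?_⟩
    · intro k hk
      have := hs₁ k hk
      by_cases h1 : k = e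
      · subst h1; dsimp only; split_ifs <;> omega
      · by_cases h2 : k = f
        · subst h2; dsimp only; split_ifs <;> omega
        · dsimp only; split_ifs <;> omega
    · simp
    · simp [he, hfn]
    · intro k hk
      have := hb₁ k hk
      have := hb₂ k hk
      have := hr k
      have := hl k
      dsimp only
      split_ifs <;> omega
    · intro k hk
      have := hs₁ k hk
      by_cases h1 : k = e
      · subst h1; dsimp only; split_ifs <;> omega
      · by_cases h2 : k = f
        · subst h2; dsimp only; split_ifs <;> omega
        · dsimp only; split_ifs <;> omega
  by_cases hc : h₂ (e + 1) < h₁ (e + 1)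
  · classical
    have hex : ∃ k, e < k ∧ h₁ k ≤ h₂ k := ⟨n, he, hn.le⟩
    have hspec := Nat.find_spec hex
    have hmin : ∀ k, e < k → k < Nat.find hex → h₂ k < h₁ k := fun k hk hlt => by
      have := Nat.find_min hex hlt
      push Not at this
      exact this hk
    have hle : Nat.find hex ≤ n := Nat.find_min' hex ⟨he, hn.le⟩
    obtain ⟨f, hf⟩ : ∃ f, Nat.find hex = f + 1 := ⟨Nat.find hex - 1, by omega⟩
    rw [hf] at hspec hmin hle
    have hef : e ≠ f := by rintro rfl; omega
    have h1 := hmin f (by omega) (by omega)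
    have h2 := hs₁ f (by omega)
    have h3 := hs₂ f (by omega)
    exact ⟨f, by omega, by omega, by omega, fun k hk hkf => hmin k hk (by omega),
      fun k hk hkf => by omega⟩
  · classical
    have hm0 : h₂ 0 ≤ h₁ 0 := h0.ge
    set f := Nat.findGreatest (fun k => h₂ k ≤ h₁ k) e with hfdef
    have hspec : h₂ f ≤ h₁ f :=
      Nat.findGreatest_spec (P := fun k => h₂ k ≤ h₁ k) (Nat.zero_le e) hm0
    have hfe : f ≤ e := Nat.findGreatest_le e
    have hgr : ∀ k, f < k → k ≤ e → h₁ k < h₂ k := fun k hk hke =>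
      not_le.1 (Nat.findGreatest_is_greatest (P := fun k => h₂ k ≤ h₁ k) hk hke)
    have hne : f ≠ e := fun h => by rw [h] at hspec; omega
    have h1 := hgr (f + 1) (by omega) (by omega)
    have h2 := hs₁ f (by omega)
    have h3 := hs₂ f (by omega)
    exact ⟨f, by omega, by omega, by omega, fun k hk hkf => by omega, hgr⟩

theorem LatticeRegion.length_eq (R : LatticeRegion) (i j : ℕ) {w : LatticePath}
    (hw : w ∈ R.pathsBetween (R.s i) (R.t j)) : w.steps.length = R.u + R.v := by
  have h1 := w.point_sum w.steps.length le_rfl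
  have h2 : w.point w.steps.length = R.t j := hw.2.1
  rw [h2, hw.1] at h1
  simp only [LatticeRegion.s, LatticeRegion.t] at h1
  omega

theorem LatticeRegion.mem_pathsBetween_iff (R : LatticeRegion) (i j : ℕ) (w : LatticePath) :
    w ∈ R.pathsBetween (R.s i) (R.t j) ↔ w.start = R.s i ∧ w.steps.length = R.u + R.v ∧
      (w.point (R.u + R.v)).2 = (R.v : ℤ) - R.c + j ∧
      ∀ k ≤ R.u + R.v, (R.P.point k).2 ≤ (w.point k).2 ∧ (w.point k).2 ≤ (R.Q.point k).2 := by
  constructor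
  · intro hw
    have hl := R.length_eq i j hw
    refine ⟨hw.1, hl, ?_, fun k hk => ?_⟩
    · have h2 : w.point w.steps.length = R.t j := hw.2.1
      rw [hl] at h2
      rw [h2]; rfl
    · obtain ⟨k', -, hsum, hb⟩ := hw.2.2 k (by omega)
      have := w.point_sum k (by omega)
      rw [hw.1] at this
      simp only [LatticeRegion.s] at this
      have : k' = k := by omega
      exact this ▸ hb
  · rintro ⟨hs, hl, ht, hb⟩
    have hsum : ∀ k ≤ R.u + R.v, (w.point k).1 + (w.point k).2 = k := fun k hk => by
      rw [w.point_sum k (by omega), hs]; simp [LatticeRegion.s]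
    refine ⟨hs, ?_, fun k hk => ⟨k, by omega, hsum k (by omega), hb k (by omega)⟩⟩
    have h1 := hsum (R.u + R.v) le_rfl
    rw [LatticePath.finish, hl]
    ext
    · simp only [LatticeRegion.t]; push_cast at h1; linarith
    · exact ht

theorem LatticeRegion.northLabels_subset (R : LatticeRegion) (i j : ℕ) {w : LatticePath}
    (hw : w ∈ R.pathsBetween (R.s i) (R.t j)) : w.northLabels ⊆ R.labels := by
  intro l hl
  obtain ⟨k, hk, -, rfl⟩ := (w.mem_northLabels (by rw [hw.1]; simp [LatticeRegion.s]) l).1 hl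
  rw [R.length_eq i j hw] at hk
  simp only [LatticeRegion.labels, Set.mem_Icc]
  omega

theorem LatticeRegion.labels_finite (R : LatticeRegion) : R.labels.Finite := Set.finite_Icc _ _

theorem LatticeRegion.exchange (R : LatticeRegion) (i j : ℕ) :
    Matroid.ExchangeProperty
      (fun B => ∃ w ∈ R.pathsBetween (R.s i) (R.t j), w.northLabels = B) := by
  rintro _ _ ⟨w₁, hw₁, rfl⟩ ⟨w₂, hw₂, rfl⟩ x ⟨hx₁, hx₂⟩
  obtain ⟨hs₁, hl₁, ht₁, hb₁⟩ := (R.mem_pathsBetween_iff i j w₁).1 hw₁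
  obtain ⟨hs₂, hl₂, ht₂, hb₂⟩ := (R.mem_pathsBetween_iff i j w₂).1 hw₂
  have hz₁ : w₁.start.1 + w₁.start.2 = 0 := by rw [hs₁]; simp [LatticeRegion.s]
  have hz₂ : w₂.start.1 + w₂.start.2 = 0 := by rw [hs₂]; simp [LatticeRegion.s]
  obtain ⟨e, he, he₁, rfl⟩ := (w₁.mem_northLabels hz₁ x).1 hx₁
  rw [hl₁] at he
  have he₂ : (w₂.point (e + 1)).2 = (w₂.point e).2 := by
    refine (w₂.height_step e (by omega)).resolve_right fun h => hx₂ ?_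
    exact (w₂.mem_northLabels hz₂ _).2 ⟨e, by omega, h, rfl⟩
  obtain ⟨f, hf, hf₂, hf₁, g, hg, hg0, hgn, hgb, hgN⟩ := LatticePath.heights_exchange
    (R.u + R.v) (fun k => (w₁.point k).2) (fun k => (w₂.point k).2)
    (fun k => (R.P.point k).2) (fun k => (R.Q.point k).2)
    (fun k hk => w₁.height_step k (by omega)) (fun k hk => w₂.height_step k (by omega))
    (by simp only [LatticePath.point_zero, hs₁, hs₂]) (ht₁.trans ht₂.symm) hb₁ hb₂ e he he₁ he₂
  refine ⟨(f : ℤ) + 1, ⟨(w₂.mem_northLabels hz₂ _).2 ⟨f, by omega, hf₂, rfl⟩, fun hc => ?_⟩, ?_⟩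
  · obtain ⟨k, hk, hkN, hkf⟩ := (w₁.mem_northLabels hz₁ _).1 hc
    obtain rfl : f = k := by omega
    omega
  · obtain ⟨w, hws, hwl, hwp⟩ := LatticePath.exists_of_heights (R.u + R.v) g hg
    rw [LatticePath.point_zero, hs₁] at hg0
    have hws' : w.start = R.s i := by rw [hws, hg0]; simp [LatticeRegion.s]
    refine ⟨w, (R.mem_pathsBetween_iff i j w).2 ⟨hws', hwl, ?_, ?_⟩, ?_⟩
    · rw [hwp _ le_rfl]; exact hgn.trans ht₁
    · intro k hk; rw [hwp k hk]; exact hgb k hk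
    · ext l
      rw [w.mem_northLabels (by rw [hws]; simp), Set.mem_insert_iff, Set.mem_sdiff,
        w₁.mem_northLabels hz₁, Set.mem_singleton_iff]
      constructor
      · rintro ⟨k, hk, hkN, rfl⟩
        rw [hwp (k + 1) (by omega), hwp k (by omega)] at hkN
        rcases (hgN k (by omega)).1 hkN with rfl | ⟨h1, h2⟩
        · exact Or.inl rfl
        · exact Or.inr ⟨⟨k, by omega, h1, rfl⟩, by omega⟩
      · have aux : ∀ k < R.u + R.v, (k = f ∨ ((w₁.point (k + 1)).2 = (w₁.point k).2 + 1 ∧ k ≠ e)) →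
            ∃ k' < w.steps.length, (w.point (k' + 1)).2 = (w.point k').2 + 1 ∧
              (k : ℤ) + 1 = (k' : ℤ) + 1 := fun k hk h => by
          refine ⟨k, by omega, ?_, rfl⟩
          rw [hwp (k + 1) (by omega), hwp k (by omega)]
          exact (hgN k hk).2 h
        rintro (rfl | ⟨⟨k, hk, hkN, rfl⟩, hke⟩)
        · exact aux f hf (Or.inl rfl)
        · exact aux k (by omega) (Or.inr ⟨hkN, by omega⟩)

/-- Basic facts on the two bounding paths. -/
theorem LatticeRegion.bounds (R : LatticeRegion) :
    R.P.steps.length = R.u + R.v ∧ R.Q.steps.length = R.u + R.v ∧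
    (R.P.point 0).2 = 0 ∧ (R.Q.point 0).2 = R.d ∧
    (R.P.point (R.u + R.v)).2 = (R.v : ℤ) - R.c ∧ (R.Q.point (R.u + R.v)).2 = R.v := by
  have hP := R.P.point_sum R.P.steps.length le_rfl
  have hQ := R.Q.point_sum R.Q.steps.length le_rfl
  have hPf : R.P.point R.P.steps.length = _ := R.P_finish
  have hQf : R.Q.point R.Q.steps.length = _ := R.Q_finish
  rw [hPf, R.P_start] at hP
  rw [hQf, R.Q_start] at hQ
  simp only [] at hP hQ
  have hPl : R.P.steps.length = R.u + R.v := by omega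
  have hQl : R.Q.steps.length = R.u + R.v := by omega
  rw [hPl] at hPf
  rw [hQl] at hQf
  refine ⟨hPl, hQl, ?_, ?_, ?_, ?_⟩
  · rw [LatticePath.point_zero, R.P_start]
  · rw [LatticePath.point_zero, R.Q_start]
  · rw [hPf]
  · rw [hQf]

theorem LatticeRegion.exists_min (R : LatticeRegion) :
    ∃ w, w ∈ R.pathsBetween (R.s R.d) (R.t 0) := by
  obtain ⟨hPl, hQl, hP0, hQ0, hPn, hQn⟩ := R.bounds
  have hle := R.le_v
  obtain ⟨w, hws, hwl, hwp⟩ := LatticePath.exists_of_heights (R.u + R.v)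
    (fun k => max (R.d : ℤ) (R.P.point k).2) (fun k hk => by
      have := R.P.height_step k (by omega)
      omega)
  have hmono : ∀ k ≤ R.u + R.v, (R.d : ℤ) ≤ (R.Q.point k).2 := fun k => by
    induction k with
    | zero => intro _; omega
    | succ k ih =>
      intro hk
      have := ih (by omega)
      have := R.Q.height_step k (by omega)
      omega
  refine ⟨w, (R.mem_pathsBetween_iff _ _ w).2 ⟨?_, hwl, ?_, fun k hk => ?_⟩⟩
  · rw [hws, hP0]; simp [LatticeRegion.s]
  · rw [hwp _ le_rfl]; dsimp only; omega
  · rw [hwp k hk]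
    have := hmono k hk
    have := R.P_below_Q k hk
    dsimp only
    omega

theorem LatticeRegion.exists_max (R : LatticeRegion) :
    ∃ w, w ∈ R.pathsBetween (R.s 0) (R.t R.c) := by
  obtain ⟨hPl, hQl, hP0, hQ0, hPn, hQn⟩ := R.bounds
  have hle := R.le_v
  obtain ⟨w, hws, hwl, hwp⟩ := LatticePath.exists_of_heights (R.u + R.v)
    (fun k => min (k : ℤ) (R.Q.point k).2) (fun k hk => by
      have := R.Q.height_step k (by omega)
      push_cast
      omega)
  have hmono : ∀ k ≤ R.u + R.v, (R.P.point k).2 ≤ k := fun k => by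
    induction k with
    | zero => intro _; omega
    | succ k ih =>
      intro hk
      have := ih (by omega)
      have := R.P.height_step k (by omega)
      push_cast
      omega
  refine ⟨w, (R.mem_pathsBetween_iff _ _ w).2 ⟨?_, hwl, ?_, fun k hk => ?_⟩⟩
  · rw [hws, hQ0]; simp [LatticeRegion.s]
  · rw [hwp _ le_rfl]; dsimp only; push_cast; omega
  · rw [hwp k hk]
    have := hmono k hk
    have := R.P_below_Q k hk
    dsimp only
    omega

/-- The lattice path matroid `M(R_min)` on `{1, …, u + v}`: its bases are the sets `b(w)` for the
paths `w` in the region from `s_Q = s_d` to `t_P = t_0`. -/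
def LatticeRegion.minMatroid (R : LatticeRegion) : Matroid ℤ :=
  Matroid.ofIsBaseOfFinite R.labels_finite
    (fun B => ∃ w ∈ R.pathsBetween (R.s R.d) (R.t 0), w.northLabels = B)
    (let ⟨w, hw⟩ := R.exists_min; ⟨w.northLabels, w, hw, rfl⟩)
    (R.exchange R.d 0)
    (fun _ ⟨_, hw, hB⟩ => hB ▸ R.northLabels_subset R.d 0 hw)

/-- The lattice path matroid `M(R_max)` on `{1, …, u + v}`: its bases are the sets `b(w)` for the
paths `w` in the region from `s_P = s_0` to `t_Q = t_c`. -/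
def LatticeRegion.maxMatroid (R : LatticeRegion) : Matroid ℤ :=
  Matroid.ofIsBaseOfFinite R.labels_finite
    (fun B => ∃ w ∈ R.pathsBetween (R.s 0) (R.t R.c), w.northLabels = B)
    (let ⟨w, hw⟩ := R.exists_max; ⟨w.northLabels, w, hw, rfl⟩)
    (R.exchange 0 R.c)
    (fun _ ⟨_, hw, hB⟩ => hB ▸ R.northLabels_subset 0 R.c hw)

/-!
Along the lines `x + y = k`, a path in the region is a height function with increments `0` and `1`
that stays between the heights of `P` and `Q`, and its north labels are the places where it increases.
A set `F` of labels is therefore the label set of a path from `s_i` to `t_j` exactly when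
`k ↦ i + northCount F k` stays between `P` and `Q` and ends at the height of `t_j`
(`LatticeRegion.exists_path_iff`).

*Quotient.*  Put `d` steps before and `c` steps after the region, so that the lower path becomes
`E^d P N^c` and the upper path `N^d Q E^c`.  Deleting the `d + c` new labels from the lattice path
matroid of this larger region forces the new steps to be east, which leaves the paths from `s_P` to
`t_Q`, that is, `M(R_max)`; contracting them forces the new steps to be north, which leaves the paths
from `s_Q` to `t_P`, that is, `M(R_min)` (`LatticeRegion.minMatroid_isQuotientOf_maxMatroid`).

*Feasible sets.*  A set is feasible when it is independent in `M(R_max)` and spanning in `M(R_min)`.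
The label set of a path with heights `h` is independent in `M(R_max)` since the heights
`max (min k h) (k - u)` belong to a path from `s_P` to `t_Q` with at least the same north steps
(`LatticeRegion.northLabels_indep`), and it spans `M(R_min)` since the heights
`min (max h d) (v - c)` belong to a path from `s_Q` to `t_P` with at most the same north steps
(`LatticeRegion.northLabels_spanning`).  Conversely, let `A ⊆ F ⊆ B` with `A` a base of `M(R_min)` and
`B` a base of `M(R_max)`.  A path with labels `F` that starts at height `x` stays between `P` and `Q`
when `P k - northCount F k ≤ x ≤ Q l - northCount F l` for all `k` and `l`.  Such an `x` exists:
for `k ≤ l`, the set `F` has at most as many labels between `k` and `l` as `B`, whose path runs from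
above `P` to below `Q`; for `l ≤ k`, it has at least as many as `A`, whose path runs from below `Q` to
above `P` (`LatticeRegion.exists_path_of_subset_of_subset`).
-/

/-! ### Counting labels -/

/-- The number of elements of `B` among the labels `1, …, k`, as an integer: the height gained in the
first `k` steps by a path with north labels `B` that starts on the line `x + y = 0`. -/
noncomputable def LatticePath.northCount (B : Set ℤ) (k : ℕ) : ℤ := by
  classical exact ∑ l ∈ Finset.range k, if (l : ℤ) + 1 ∈ B then 1 else 0

namespace LatticePath

theorem northCount_zero (B : Set ℤ) : northCount B 0 = 0 := by simp [northCount]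

theorem northCount_succ_of_mem {B : Set ℤ} {k : ℕ} (h : (k : ℤ) + 1 ∈ B) :
    northCount B (k + 1) = northCount B k + 1 := by
  rw [northCount, northCount, Finset.sum_range_succ, if_pos h]

theorem northCount_succ_of_notMem {B : Set ℤ} {k : ℕ} (h : (k : ℤ) + 1 ∉ B) :
    northCount B (k + 1) = northCount B k := by
  rw [northCount, northCount, Finset.sum_range_succ, if_neg h, add_zero]

theorem northCount_step (B : Set ℤ) (k : ℕ) :
    northCount B (k + 1) = northCount B k ∨ northCount B (k + 1) = northCount B k + 1 := by
  by_cases h : (k : ℤ) + 1 ∈ B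
  · exact Or.inr (northCount_succ_of_mem h)
  · exact Or.inl (northCount_succ_of_notMem h)

theorem northCount_succ_iff (B : Set ℤ) (k : ℕ) :
    northCount B (k + 1) = northCount B k + 1 ↔ (k : ℤ) + 1 ∈ B := by
  refine ⟨fun h => ?_, northCount_succ_of_mem⟩
  by_contra hc
  rw [northCount_succ_of_notMem hc] at h
  omega

/-- Over any interval of labels, a subset has at most as many elements as a superset. -/
theorem northCount_sub_le {A B : Set ℤ} (h : A ⊆ B) {j k : ℕ} (hjk : j ≤ k) :
    northCount A k - northCount A j ≤ northCount B k - northCount B j := by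
  induction k, hjk using Nat.le_induction with
  | base => omega
  | succ k _ ih =>
    by_cases hA : (k : ℤ) + 1 ∈ A
    · rw [northCount_succ_of_mem hA, northCount_succ_of_mem (h hA)]
      omega
    · rw [northCount_succ_of_notMem hA]
      have := northCount_step B k
      omega

/-- A height function with unit increments is, up to its initial value, the counting function of the
set of labels at which it increases. -/
theorem eq_add_northCount {n : ℕ} {g : ℕ → ℤ}
    (hg : ∀ k < n, g (k + 1) = g k ∨ g (k + 1) = g k + 1) {B : Set ℤ}
    (hB : ∀ k < n, g (k + 1) = g k + 1 ↔ (k : ℤ) + 1 ∈ B) {k : ℕ} (hk : k ≤ n) :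
    g k = g 0 + northCount B k := by
  induction k with
  | zero => rw [northCount_zero, add_zero]
  | succ k ih =>
    have := ih (by omega)
    by_cases h : (k : ℤ) + 1 ∈ B
    · rw [northCount_succ_of_mem h, (hB k hk).2 h]
      omega
    · rw [northCount_succ_of_notMem h, (hg k hk).resolve_right fun h' => h ((hB k hk).1 h')]
      exact this

end LatticePath

/-! ### The label sets of the paths between two given points -/

namespace LatticeRegion

open LatticePath

/-- A set of labels is the label set of a path from `s_i` to `t_j` in the region exactly when its
counting function, shifted by `i`, ends at the height of `t_j` and stays between `P` and `Q`. -/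
theorem exists_path_iff (R : LatticeRegion) (i j : ℕ) (B : Set ℤ) :
    (∃ w ∈ R.pathsBetween (R.s i) (R.t j), w.northLabels = B) ↔
      B ⊆ R.labels ∧ (i : ℤ) + northCount B (R.u + R.v) = (R.v : ℤ) - R.c + j ∧
      ∀ k ≤ R.u + R.v, (R.P.point k).2 ≤ i + northCount B k ∧
        i + northCount B k ≤ (R.Q.point k).2 := by
  constructor
  · rintro ⟨w, hw, rfl⟩
    obtain ⟨hs, hl, ht, hb⟩ := (R.mem_pathsBetween_iff i j w).1 hw
    have hz : w.start.1 + w.start.2 = 0 := by rw [hs]; simp [LatticeRegion.s]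
    have key : ∀ k ≤ R.u + R.v, (w.point k).2 = i + northCount w.northLabels k := fun k hk => by
      rw [eq_add_northCount (g := fun k => (w.point k).2)
        (fun k hk => w.height_step k (by omega)) (B := w.northLabels) (fun k hk => ?_) hk]
      · simp only [point_zero, hs, LatticeRegion.s]
      · rw [w.mem_northLabels hz]
        constructor
        · exact fun h => ⟨k, by omega, h, rfl⟩
        · rintro ⟨k', -, h, hkk⟩
          obtain rfl : k = k' := by omega
          exact h
    refine ⟨R.northLabels_subset i j hw, key _ le_rfl ▸ ht, fun k hk => key k hk ▸ hb k hk⟩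
  · rintro ⟨hB, ht, hb⟩
    obtain ⟨w, hws, hwl, hwp⟩ := exists_of_heights (R.u + R.v) (fun k => i + northCount B k)
      (fun k _ => by have := northCount_step B k; omega)
    simp only [northCount_zero, add_zero] at hws
    refine ⟨w, (R.mem_pathsBetween_iff i j w).2 ⟨hws, hwl, ?_, fun k hk => ?_⟩, ?_⟩
    · rw [hwp _ le_rfl]; exact ht
    · rw [hwp k hk]; exact hb k hk
    · ext l
      rw [w.mem_northLabels (by rw [hws]; simp)]
      constructor
      · rintro ⟨k, hk, h, rfl⟩
        rw [hwp (k + 1) (by omega), hwp k (by omega)] at h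
        exact (northCount_succ_iff B k).1 (by dsimp only at h; omega)
      · intro hl
        have hlE := hB hl
        simp only [LatticeRegion.labels, Set.mem_Icc] at hlE
        obtain ⟨k, rfl⟩ : ∃ k : ℕ, l = (k : ℤ) + 1 := ⟨(l - 1).toNat, by omega⟩
        refine ⟨k, by omega, ?_, rfl⟩
        rw [hwp (k + 1) (by omega), hwp k (by omega)]
        have := northCount_succ_of_mem hl
        dsimp only
        omega

theorem minMatroid_isBase_iff (R : LatticeRegion) (B : Set ℤ) :
    R.minMatroid.IsBase B ↔ B ⊆ R.labels ∧
      (R.d : ℤ) + northCount B (R.u + R.v) = (R.v : ℤ) - R.c ∧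
      ∀ k ≤ R.u + R.v, (R.P.point k).2 ≤ R.d + northCount B k ∧
        R.d + northCount B k ≤ (R.Q.point k).2 := by
  refine (R.exists_path_iff R.d 0 B).trans ?_
  simp

theorem maxMatroid_isBase_iff (R : LatticeRegion) (B : Set ℤ) :
    R.maxMatroid.IsBase B ↔ B ⊆ R.labels ∧ northCount B (R.u + R.v) = R.v ∧
      ∀ k ≤ R.u + R.v, (R.P.point k).2 ≤ northCount B k ∧
        northCount B k ≤ (R.Q.point k).2 := by
  refine (R.exists_path_iff 0 R.c B).trans ?_
  simp

/-- A height function with unit increments that stays between `P` and `Q` comes from a path. -/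
theorem exists_path_of_heights (R : LatticeRegion) (i j : ℕ) (g : ℕ → ℤ)
    (hg : ∀ k < R.u + R.v, g (k + 1) = g k ∨ g (k + 1) = g k + 1) (h0 : g 0 = i)
    (hn : g (R.u + R.v) = (R.v : ℤ) - R.c + j)
    (hb : ∀ k ≤ R.u + R.v, (R.P.point k).2 ≤ g k ∧ g k ≤ (R.Q.point k).2) :
    ∃ w ∈ R.pathsBetween (R.s i) (R.t j), ∀ l, l ∈ w.northLabels ↔
      ∃ k < R.u + R.v, g (k + 1) = g k + 1 ∧ l = (k : ℤ) + 1 := by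
  obtain ⟨w, hws, hwl, hwp⟩ := exists_of_heights (R.u + R.v) g hg
  refine ⟨w, (R.mem_pathsBetween_iff i j w).2 ⟨?_, hwl, ?_, fun k hk => ?_⟩, fun l => ?_⟩
  · rw [hws, h0]; rfl
  · rw [hwp _ le_rfl]; exact hn
  · rw [hwp k hk]; exact hb k hk
  · rw [w.mem_northLabels (by rw [hws]; simp), hwl]
    refine exists_congr fun k => and_congr_right fun hk => ?_
    rw [hwp (k + 1) (by omega), hwp k (by omega)]

/-! ### Feasible sets and paths -/

/-- The label set of a path in the region lies in a base of `M(R_max)`: turning east steps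
into north steps at the beginning until the path is met again, and likewise at the end, moves the end
points to `s_P` and `t_Q` and only adds labels. -/
theorem northLabels_indep (R : LatticeRegion) {w : LatticePath} (hw : w ∈ R.paths) :
    R.maxMatroid.Indep w.northLabels := by
  obtain ⟨i, hi, j, hj, hw⟩ := hw
  obtain ⟨hs, hl, ht, hb⟩ := (R.mem_pathsBetween_iff i j w).1 hw
  obtain ⟨hPl, hQl, hP0, hQ0, hPn, hQn⟩ := R.bounds
  have hle := R.le_v
  have hstep : ∀ k < R.u + R.v, _ := fun k hk => w.height_step k (by omega)
  have h0 : (w.point 0).2 = i := by rw [point_zero, hs]; rfl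
  have hPk : ∀ k ≤ R.u + R.v, (R.P.point k).2 ≤ k := fun k => by
    induction k with
    | zero => intro _; omega
    | succ k ih =>
      intro hk
      have := ih (by omega)
      have := R.P.height_step k (by omega)
      push_cast
      omega
  have hQk : ∀ k ≤ R.u + R.v, (k : ℤ) - R.u ≤ (R.Q.point k).2 := fun k hk => by
    induction hk using Nat.decreasingInduction with
    | self => push_cast; omega
    | of_succ k hk ih =>
      have := R.Q.height_step k (by omega)
      push_cast at ih
      omega
  obtain ⟨w', hw', hN⟩ := R.exists_path_of_heights 0 R.c
    (fun k => max (min (k : ℤ) (w.point k).2) ((k : ℤ) - R.u))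
    (fun k hk => by have := hstep k hk; push_cast; omega)
    (by push_cast; omega) (by push_cast; omega)
    (fun k hk => by
      have := hPk k hk
      have := hQk k hk
      have := hb k hk
      omega)
  have hbase : R.maxMatroid.IsBase w'.northLabels := ⟨w', hw', rfl⟩
  refine hbase.indep.subset fun l hlw => ?_
  obtain ⟨k, hk, hkN, rfl⟩ := (w.mem_northLabels (by rw [hs]; simp [LatticeRegion.s]) l).1 hlw
  refine (hN _).2 ⟨k, by omega, ?_, rfl⟩
  push_cast
  omega

/-- The label set of a path in the region contains a base of `M(R_min)`: truncating the heights to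
the interval from the height of `s_Q` to the height of `t_P` only removes labels. -/
theorem northLabels_spanning (R : LatticeRegion) {w : LatticePath} (hw : w ∈ R.paths) :
    R.minMatroid.Spanning w.northLabels := by
  obtain ⟨i, hi, j, hj, hw⟩ := hw
  obtain ⟨hs, hl, ht, hb⟩ := (R.mem_pathsBetween_iff i j w).1 hw
  obtain ⟨hPl, hQl, hP0, hQ0, hPn, hQn⟩ := R.bounds
  have hle := R.le_v
  have hstep : ∀ k < R.u + R.v, _ := fun k hk => w.height_step k (by omega)
  have h0 : (w.point 0).2 = i := by rw [point_zero, hs]; rfl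
  have hQk : ∀ k ≤ R.u + R.v, (R.d : ℤ) ≤ (R.Q.point k).2 := fun k => by
    induction k with
    | zero => intro _; omega
    | succ k ih =>
      intro hk
      have := ih (by omega)
      have := R.Q.height_step k (by omega)
      omega
  have hPk : ∀ k ≤ R.u + R.v, (R.P.point k).2 ≤ (R.v : ℤ) - R.c := fun k hk => by
    induction hk using Nat.decreasingInduction with
    | self => omega
    | of_succ k hk ih =>
      have := R.P.height_step k (by omega)
      omega
  obtain ⟨w', hw', hN⟩ := R.exists_path_of_heights R.d 0
    (fun k => min (max (w.point k).2 R.d) ((R.v : ℤ) - R.c))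
    (fun k hk => by have := hstep k hk; omega)
    (by omega) (by push_cast; omega)
    (fun k hk => by
      have := hPk k hk
      have := hQk k hk
      have := hb k hk
      omega)
  have hbase : R.minMatroid.IsBase w'.northLabels := ⟨w', hw', rfl⟩
  refine hbase.spanning_of_superset (fun l hlw => ?_) (R.northLabels_subset i j hw)
  obtain ⟨k, hk, hkN, rfl⟩ := (hN l).1 hlw
  refine (w.mem_northLabels (by rw [hs]; simp [LatticeRegion.s]) _).2 ⟨k, by omega, ?_, rfl⟩
  have := hstep k hk
  omega

/-- Every set `F` between a base `A` of `M(R_min)` and a base `B` of `M(R_max)` is the label set of a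
path in the region. -/
theorem exists_path_of_subset_of_subset (R : LatticeRegion) {A F B : Set ℤ}
    (hA : R.minMatroid.IsBase A) (hB : R.maxMatroid.IsBase B) (hAF : A ⊆ F) (hFB : F ⊆ B) :
    ∃ w ∈ R.paths, w.northLabels = F := by
  obtain ⟨-, -, hAb⟩ := (R.minMatroid_isBase_iff A).1 hA
  obtain ⟨hBE, -, hBb⟩ := (R.maxMatroid_isBase_iff B).1 hB
  obtain ⟨hPl, hQl, hP0, hQ0, hPn, hQn⟩ := R.bounds
  -- The smallest starting height for which the path with labels `F` stays above `P`.
  obtain ⟨m, hm, hmax⟩ := Finset.exists_max_image (Finset.range (R.u + R.v + 1))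
    (fun k => (R.P.point k).2 - northCount F k) ⟨0, by simp⟩
  simp only [Finset.mem_range, Nat.lt_succ_iff] at hm hmax
  set x := (R.P.point m).2 - northCount F m with hx
  have hup : ∀ k ≤ R.u + R.v, x ≤ (R.Q.point k).2 - northCount F k := fun k hk => by
    rcases le_total m k with hmk | hkm
    · have := northCount_sub_le hFB hmk
      have := hBb k hk
      have := hBb m hm
      omega
    · have := northCount_sub_le hAF hkm
      have := hAb k hk
      have := hAb m hm
      omega
  have h0 := hmax 0 (by omega)
  have h0' := hup 0 (by omega)
  have hn := hmax (R.u + R.v) le_rfl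
  have hn' := hup (R.u + R.v) le_rfl
  rw [northCount_zero] at h0 h0'
  obtain ⟨i, hi⟩ : ∃ i : ℕ, x = i := ⟨x.toNat, by omega⟩
  obtain ⟨j, hj⟩ : ∃ j : ℕ, x + northCount F (R.u + R.v) = (R.v : ℤ) - R.c + j :=
    ⟨(x + northCount F (R.u + R.v) - ((R.v : ℤ) - R.c)).toNat, by omega⟩
  obtain ⟨w, hw, hwF⟩ := (R.exists_path_iff i j F).2 ⟨hFB.trans hBE, by rw [← hi, hj],
    fun k hk => by
      have := hmax k hk
      have := hup k hk
      omega⟩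
  exact ⟨w, ⟨i, by omega, j, by omega, hw⟩, hwF⟩

end LatticeRegion

/-! ### A criterion for quotients in terms of bases -/

/-- If the bases of `L` are the bases of `N` that avoid `X`, and the bases of `Q` are what the bases
of `N` containing `X` leave outside `X`, then `Q` is a quotient of `L`: the set `X` is then both
coindependent and independent in `N`, which makes the bases of `N ＼ X` and `N ／ X` explicit. -/
theorem Matroid.isQuotientOf_of_isBase_iff {α : Type*} {β : Type} {Q L : Matroid α}
    (N : Matroid (α ⊕ β)) [N.Finite] (X : Set β) (hE : Q.E = L.E)
    (hN : N.E = Sum.inl '' L.E ∪ Sum.inr '' X)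
    (hL : ∀ B, L.IsBase B ↔ N.IsBase (Sum.inl '' B))
    (hQ : ∀ B, Q.IsBase B ↔ N.IsBase (Sum.inl '' B ∪ Sum.inr '' X)) : Q.IsQuotientOf L := by
  have hX : (Set.range Sum.inr : Set (α ⊕ β)) ∩ N.E = Sum.inr '' X := by
    rw [hN]; ext (a | b) <;> simp
  have hsd : N.E \ Sum.inr '' X = Sum.inl '' L.E := by
    rw [hN]; ext (a | b) <;> simp
  refine ⟨β, N, inferInstance, ?_, ?_⟩
  · rw [← Matroid.delete_inter_ground_eq, hX]
    obtain ⟨B₀, hB₀⟩ := L.exists_isBase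
    have hco : N.Coindep (Sum.inr '' X) := by
      refine Matroid.coindep_iff_exists'.2 ⟨⟨_, (hL B₀).1 hB₀, ?_⟩, hX ▸ Set.inter_subset_right⟩
      rw [hsd]
      exact Set.image_mono hB₀.subset_ground
    refine Matroid.ext_isBase (by rw [Matroid.delete_ground, hsd]; rfl) fun B hB => ?_
    rw [Matroid.delete_ground, hsd] at hB
    obtain ⟨B, -, rfl⟩ := Set.subset_image_iff.1 hB
    have hpre : (Function.Embedding.inl : α ↪ α ⊕ β) ⁻¹' (Sum.inl '' B) = B :=
      Set.preimage_image_eq B Sum.inl_injective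
    rw [hco.delete_isBase_iff, Matroid.mapEmbedding_isBase_iff, hpre, hL]
    exact and_congr_right fun _ => iff_of_true
      (Set.disjoint_left.2 (by rintro _ ⟨a, -, rfl⟩ ⟨b, -, h⟩; cases h))
      (Set.image_subset_range _ _)
  · rw [← Matroid.contract_inter_ground_eq, hX]
    obtain ⟨B₀, hB₀⟩ := Q.exists_isBase
    have hin : N.Indep (Sum.inr '' X) :=
      ((hQ B₀).1 hB₀).indep.subset Set.subset_union_right
    refine Matroid.ext_isBase (by rw [Matroid.contract_ground, hsd, ← hE]; rfl) fun B hB => ?_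
    rw [Matroid.contract_ground, hsd] at hB
    obtain ⟨B, -, rfl⟩ := Set.subset_image_iff.1 hB
    have hpre : (Function.Embedding.inl : α ↪ α ⊕ β) ⁻¹' (Sum.inl '' B) = B :=
      Set.preimage_image_eq B Sum.inl_injective
    rw [hin.contract_isBase_iff, Matroid.mapEmbedding_isBase_iff, hpre, hQ]
    exact and_congr_right fun _ => iff_of_true
      (Set.disjoint_left.2 (by rintro _ ⟨a, -, rfl⟩ ⟨b, -, h⟩; cases h))
      (Set.image_subset_range _ _)

/-! ### The extended region -/

namespace LatticeRegion

open LatticePath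

/-- The region with corners `s_P - (d, 0)` and `t_Q + (c, 0)`, translated to start at the origin:
its lower path is `E^d P N^c` and its upper path is `N^d Q E^c`.  The heights are written with
truncated subtraction of natural numbers, so that `min (k - d) (u + v)` is the number of steps of `P`
or `Q` among the first `k` steps. -/
theorem exists_extension (R : LatticeRegion) :
    ∃ S : LatticeRegion, S.u = R.u + R.c + R.d ∧ S.v = R.v ∧ S.c = 0 ∧ S.d = 0 ∧
      ∀ k ≤ S.u + S.v,
        (S.P.point k).2 = (R.P.point (min (k - R.d) (R.u + R.v))).2 +
          ((k - (R.d + (R.u + R.v)) : ℕ) : ℤ) ∧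
        (S.Q.point k).2 = (R.Q.point (min (k - R.d) (R.u + R.v))).2 - ((R.d - k : ℕ) : ℤ) := by
  obtain ⟨hPl, hQl, hP0, hQ0, hPn, hQn⟩ := R.bounds
  -- Step `k` lies before the steps of `w`, after them, or is one of them.
  have hstep : ∀ (w : LatticePath), w.steps.length = R.u + R.v → ∀ k,
      (k < R.d ∧ min (k - R.d) (R.u + R.v) = 0 ∧ min (k + 1 - R.d) (R.u + R.v) = 0) ∨
      (R.d + (R.u + R.v) ≤ k ∧ min (k - R.d) (R.u + R.v) = R.u + R.v ∧
        min (k + 1 - R.d) (R.u + R.v) = R.u + R.v) ∨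
      (R.d ≤ k ∧ k < R.d + (R.u + R.v) ∧
        ((w.point (min (k + 1 - R.d) (R.u + R.v))).2 =
            (w.point (min (k - R.d) (R.u + R.v))).2 ∨
          (w.point (min (k + 1 - R.d) (R.u + R.v))).2 =
            (w.point (min (k - R.d) (R.u + R.v))).2 + 1)) := fun w hw k => by
    rcases lt_or_ge k R.d with h1 | h1
    · exact Or.inl ⟨h1, by omega, by omega⟩
    rcases lt_or_ge k (R.d + (R.u + R.v)) with h2 | h2
    · have h3 : min (k + 1 - R.d) (R.u + R.v) = min (k - R.d) (R.u + R.v) + 1 := by omega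
      rw [h3]
      exact Or.inr (Or.inr ⟨h1, h2, w.height_step _ (by omega)⟩)
    · exact Or.inr (Or.inl ⟨h2, by omega, by omega⟩)
  obtain ⟨P, hPs, hPl', hPp⟩ := exists_of_heights (R.u + R.c + R.d + R.v)
    (fun k => (R.P.point (min (k - R.d) (R.u + R.v))).2 +
      ((k - (R.d + (R.u + R.v)) : ℕ) : ℤ)) (fun k _ => by
        rcases hstep R.P hPl k with ⟨h, h1, h2⟩ | ⟨h, h1, h2⟩ | ⟨h, h', h1⟩
        · rw [h1, h2]; omega
        · rw [h1, h2]; omega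
        · omega)
  obtain ⟨Q, hQs, hQl', hQp⟩ := exists_of_heights (R.u + R.c + R.d + R.v)
    (fun k => (R.Q.point (min (k - R.d) (R.u + R.v))).2 - ((R.d - k : ℕ) : ℤ)) (fun k _ => by
        rcases hstep R.Q hQl k with ⟨h, h1, h2⟩ | ⟨h, h1, h2⟩ | ⟨h, h', h1⟩
        · rw [h1, h2]; omega
        · rw [h1, h2]; omega
        · omega)
  have h0 : min (0 - R.d) (R.u + R.v) = 0 := by omega
  have hn : min (R.u + R.c + R.d + R.v - R.d) (R.u + R.v) = R.u + R.v := by omega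
  refine ⟨{
    u := R.u + R.c + R.d
    v := R.v
    c := 0
    d := 0
    le_v := Nat.zero_le _
    P := P
    Q := Q
    P_start := ?_
    P_finish := ?_
    Q_start := ?_
    Q_finish := ?_
    P_below_Q := ?_ }, rfl, rfl, rfl, rfl, fun k hk => ?_⟩
  · rw [hPs, h0, hP0]; simp
  · rw [LatticePath.finish, hPl', hPp _ le_rfl, hn, hPn]
    ext <;> dsimp only <;> push_cast <;> omega
  · rw [hQs, h0, hQ0]; simp
  · rw [LatticePath.finish, hQl', hQp _ le_rfl, hn, hQn]
    ext <;> dsimp only <;> push_cast <;> omega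
  · intro k hk
    rw [hPp k hk, hQp k hk]
    dsimp only
    rcases hstep R.P hPl k with ⟨h, h1, h2⟩ | ⟨h, h1, h2⟩ | ⟨h, h', h1⟩
    · rw [h1]; omega
    · rw [h1]; omega
    · have := R.P_below_Q (min (k - R.d) (R.u + R.v)) (by omega)
      omega
  · dsimp only at hk ⊢
    exact ⟨by rw [hPp k hk], by rw [hQp k hk]⟩

end LatticeRegion

/-- Translating a set of labels from `1, …, n` to `d + 1, …, d + n`, and adding no labels outside
that range, delays its counting function by `d` steps. -/
theorem LatticePath.northCount_translate {d n : ℕ} {B C : Set ℤ}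
    (h1 : ∀ k < d, (k : ℤ) + 1 ∉ C) (h2 : ∀ k < n, ((d + k : ℕ) : ℤ) + 1 ∈ C ↔ (k : ℤ) + 1 ∈ B)
    (h3 : ∀ k ≥ d + n, (k : ℤ) + 1 ∉ C) (k : ℕ) :
    northCount C k = northCount B (min (k - d) n) := by
  induction k with
  | zero => simp [northCount_zero]
  | succ k ih =>
    rcases lt_or_ge k d with hk | hk
    · rw [northCount_succ_of_notMem (h1 k hk), ih]
      congr 1; omega
    rcases lt_or_ge k (d + n) with hk' | hk'
    · obtain ⟨m, rfl⟩ := Nat.exists_eq_add_of_le hk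
      rw [show min (d + m + 1 - d) n = m + 1 by omega]
      rw [show min (d + m - d) n = m by omega] at ih
      by_cases hm : (m : ℤ) + 1 ∈ B
      · rw [northCount_succ_of_mem hm, northCount_succ_of_mem ((h2 m (by omega)).2 hm), ih]
      · rw [northCount_succ_of_notMem hm,
          northCount_succ_of_notMem fun h => hm ((h2 m (by omega)).1 h), ih]
    · rw [northCount_succ_of_notMem (h3 k hk'), ih]
      congr 1; omega

/-- Translating a set of labels from `1, …, n` to `d + 1, …, d + n`, and adding all labels up to
`m` outside that range. -/
theorem LatticePath.northCount_translate_union {d n : ℕ} {B C : Set ℤ} {m : ℕ}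
    (h1 : ∀ k < d, (k : ℤ) + 1 ∈ C) (h2 : ∀ k < n, ((d + k : ℕ) : ℤ) + 1 ∈ C ↔ (k : ℤ) + 1 ∈ B)
    (h3 : ∀ k ≥ d + n, k < m → (k : ℤ) + 1 ∈ C) (k : ℕ) (hkm : k ≤ m) :
    northCount C k =
      (min k d : ℕ) + northCount B (min (k - d) n) + ((k - (d + n) : ℕ) : ℤ) := by
  induction k with
  | zero => simp [northCount_zero]
  | succ k ih =>
    have ih := ih (by omega)
    rcases lt_or_ge k d with hk | hk
    · rw [northCount_succ_of_mem (h1 k hk), ih, show min (k - d) n = 0 by omega,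
        show min (k + 1 - d) n = 0 by omega]
      omega
    rcases lt_or_ge k (d + n) with hk' | hk'
    · obtain ⟨l, rfl⟩ := Nat.exists_eq_add_of_le hk
      rw [show min (d + l + 1 - d) n = l + 1 by omega]
      rw [show min (d + l - d) n = l by omega] at ih
      by_cases hl : (l : ℤ) + 1 ∈ B
      · rw [northCount_succ_of_mem hl, northCount_succ_of_mem ((h2 l (by omega)).2 hl), ih]
        omega
      · rw [northCount_succ_of_notMem hl,
          northCount_succ_of_notMem fun h => hl ((h2 l (by omega)).1 h), ih]
        omega
    · rw [northCount_succ_of_mem (h3 k hk' (by omega)), ih, show min (k - d) n = n by omega,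
        show min (k + 1 - d) n = n by omega]
      omega

/-! ### The quotient and the feasible sets -/

namespace LatticeRegion

open LatticePath

/-- The relabelling of the extended region: the `u + v` middle labels become the labels of the
original region, in the left summand, and all other labels go to the right summand. -/
def extensionRelabel (R : LatticeRegion) : ℤ ↪ ℤ ⊕ ℤ where
  toFun l := if (R.d : ℤ) < l ∧ l ≤ R.d + (R.u + R.v) then Sum.inl (l - R.d) else Sum.inr l
  inj' := by
    intro a b h
    dsimp only at h
    split_ifs at h
    · have := Sum.inl_injective h; omega
    · exact Sum.inr_injective h

theorem extensionRelabel_of_mem (R : LatticeRegion) {l : ℤ}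
    (h : (R.d : ℤ) < l ∧ l ≤ R.d + (R.u + R.v)) : R.extensionRelabel l = Sum.inl (l - R.d) :=
  if_pos h

theorem extensionRelabel_of_notMem (R : LatticeRegion) {l : ℤ}
    (h : ¬ ((R.d : ℤ) < l ∧ l ≤ R.d + (R.u + R.v))) : R.extensionRelabel l = Sum.inr l :=
  if_neg h

theorem image_inl_subset_range_extensionRelabel (R : LatticeRegion) {B : Set ℤ}
    (hB : B ⊆ R.labels) : Sum.inl '' B ⊆ Set.range R.extensionRelabel := by
  rintro _ ⟨l, hl, rfl⟩
  have := hB hl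
  simp only [LatticeRegion.labels, Set.mem_Icc] at this
  exact ⟨l + R.d, by rw [R.extensionRelabel_of_mem (by omega)]; simp⟩

/-- `M(R_min)` is a quotient of `M(R_max)`.  In the lattice path matroid of the extended region,
deleting the first `d` and the last `c` labels leaves the paths `E^d w E^c` with `w` from `s_P` to
`t_Q`, and contracting them leaves the paths `N^d w N^c` with `w` from `s_Q` to `t_P`. -/
theorem minMatroid_isQuotientOf_maxMatroid (R : LatticeRegion) :
    R.minMatroid.IsQuotientOf R.maxMatroid := by
  obtain ⟨S, hu, hv, hc, hd, hpt⟩ := R.exists_extension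
  obtain ⟨-, -, hP0, hQ0, hPn, hQn⟩ := R.bounds
  have hle := R.le_v
  have : S.minMatroid.Finite := ⟨S.labels_finite⟩
  have hSn : S.u + S.v = R.d + (R.u + R.v) + R.c := by omega
  have hSE : S.labels = Set.Icc 1 ((R.d : ℤ) + (R.u + R.v) + R.c) := by
    rw [LatticeRegion.labels]; congr 1; omega
  let X : Set ℤ := S.labels \ Set.Ioc (R.d : ℤ) (R.d + (R.u + R.v))
  have hXr : Sum.inr '' X ⊆ Set.range R.extensionRelabel := by
    rintro _ ⟨l, hl, rfl⟩
    exact ⟨l, R.extensionRelabel_of_notMem hl.2⟩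
  refine Matroid.isQuotientOf_of_isBase_iff (S.minMatroid.mapEmbedding R.extensionRelabel) X rfl
    ?_ (fun B => ?_) (fun B => ?_)
  · change R.extensionRelabel '' S.labels = Sum.inl '' R.labels ∪ Sum.inr '' X
    ext z
    constructor
    · rintro ⟨l, hl, rfl⟩
      by_cases h : (R.d : ℤ) < l ∧ l ≤ R.d + (R.u + R.v)
      · rw [R.extensionRelabel_of_mem h]
        exact Or.inl ⟨_, ⟨by omega, by omega⟩, rfl⟩
      · rw [R.extensionRelabel_of_notMem h]
        exact Or.inr ⟨l, ⟨hl, h⟩, rfl⟩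
    · rintro (⟨l, hl, rfl⟩ | ⟨l, hl, rfl⟩)
      · simp only [LatticeRegion.labels, Set.mem_Icc] at hl
        refine ⟨l + R.d, ?_, by rw [R.extensionRelabel_of_mem (by omega)]; simp⟩
        rw [hSE, Set.mem_Icc]
        omega
      · exact ⟨l, hl.1, R.extensionRelabel_of_notMem hl.2⟩
  · rw [Matroid.mapEmbedding_isBase_iff, R.maxMatroid_isBase_iff, S.minMatroid_isBase_iff]
    set C : Set ℤ := R.extensionRelabel ⁻¹' (Sum.inl '' B) with hC
    have hmem : ∀ l : ℤ, l ∈ C ↔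
        ((R.d : ℤ) < l ∧ l ≤ R.d + (R.u + R.v)) ∧ l - R.d ∈ B := fun l => by
      rw [hC, Set.mem_preimage]
      by_cases h : (R.d : ℤ) < l ∧ l ≤ R.d + (R.u + R.v)
      · rw [R.extensionRelabel_of_mem h, Sum.inl_injective.mem_set_image, and_iff_right h]
      · rw [R.extensionRelabel_of_notMem h]
        simp [h]
    have hcount := northCount_translate (d := R.d) (n := R.u + R.v) (B := B) (C := C)
      (fun k hk h => by have := (hmem _).1 h; omega)
      (fun k hk => by
        rw [hmem, show (((R.d + k : ℕ) : ℤ) + 1 - R.d) = k + 1 by push_cast; ring,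
          and_iff_right (by push_cast; omega)])
      (fun k hk h => by have := (hmem _).1 h; omega)
    have hBE : B ⊆ R.labels ↔ C ⊆ S.labels ∧
        Sum.inl '' B ⊆ Set.range R.extensionRelabel := by
      refine ⟨fun h => ⟨fun l hl => ?_, R.image_inl_subset_range_extensionRelabel h⟩,
        fun h l hl => ?_⟩
      · have := ((hmem l).1 hl).1
        rw [hSE, Set.mem_Icc]; omega
      · obtain ⟨m, hm⟩ := h.2 ⟨l, hl, rfl⟩
        by_cases h : (R.d : ℤ) < m ∧ m ≤ R.d + (R.u + R.v)
        · rw [R.extensionRelabel_of_mem h] at hm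
          have := Sum.inl_injective hm
          simp only [LatticeRegion.labels, Set.mem_Icc]; omega
        · rw [R.extensionRelabel_of_notMem h] at hm
          cases hm
    rw [hBE]
    have hlast : northCount C (S.u + S.v) = northCount B (R.u + R.v) := by
      rw [hcount]; congr 1; omega
    -- On the added steps the bounds of the larger region hold automatically: in the last `c` steps
    -- because the path is already at its final height.
    have hbounds : northCount B (R.u + R.v) = R.v →
        ((∀ k ≤ R.u + R.v, (R.P.point k).2 ≤ northCount B k ∧
            northCount B k ≤ (R.Q.point k).2) ↔
          ∀ k ≤ S.u + S.v, (S.P.point k).2 ≤ S.d + northCount C k ∧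
            S.d + northCount C k ≤ (S.Q.point k).2) := fun hB => by
      constructor
      · intro h k hk
        obtain ⟨h1, h2⟩ := hpt k hk
        have h3 := h (min (k - R.d) (R.u + R.v)) (by omega)
        rw [hcount, h1, h2, hd]
        rcases lt_or_ge k R.d with hk1 | hk1
        · rw [show min (k - R.d) (R.u + R.v) = 0 by omega, northCount_zero, hP0, hQ0]
          omega
        rcases le_or_gt k (R.d + (R.u + R.v)) with hk2 | hk2
        · omega
        · rw [show min (k - R.d) (R.u + R.v) = R.u + R.v by omega, hB, hPn, hQn]
          omega
      · intro h k hk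
        obtain ⟨h1, h2⟩ := hpt (R.d + k) (by omega)
        have h3 := h (R.d + k) (by omega)
        rw [hcount, h1, h2, hd, show min (R.d + k - R.d) (R.u + R.v) = k by omega] at h3
        omega
    constructor
    · rintro ⟨⟨h1, h2⟩, h3, h4⟩
      exact ⟨⟨h1, by rw [hlast, h3, hd, hv, hc]; simp, (hbounds h3).1 h4⟩, h2⟩
    · rintro ⟨⟨h1, h3, h4⟩, h2⟩
      have h3 : northCount B (R.u + R.v) = R.v := by
        rw [hlast, hd, hv, hc] at h3; simpa using h3
      exact ⟨⟨h1, h2⟩, h3, (hbounds h3).2 h4⟩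
  · rw [Matroid.mapEmbedding_isBase_iff, R.minMatroid_isBase_iff, S.minMatroid_isBase_iff]
    set C : Set ℤ := R.extensionRelabel ⁻¹' (Sum.inl '' B ∪ Sum.inr '' X) with hC
    have hmem : ∀ l : ℤ, l ∈ C ↔
        (((R.d : ℤ) < l ∧ l ≤ R.d + (R.u + R.v)) ∧ l - R.d ∈ B) ∨ l ∈ X := fun l => by
      rw [hC, Set.mem_preimage]
      by_cases h : (R.d : ℤ) < l ∧ l ≤ R.d + (R.u + R.v)
      · have hX : l ∉ X := fun hl => hl.2 h
        rw [R.extensionRelabel_of_mem h]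
        simp [h, hX]
      · rw [R.extensionRelabel_of_notMem h]
        simp [h]
    have hmemX : ∀ l : ℤ, l ∈ X ↔ (1 ≤ l ∧ l ≤ (R.d : ℤ) + (R.u + R.v) + R.c) ∧
        ¬ ((R.d : ℤ) < l ∧ l ≤ R.d + (R.u + R.v)) := fun l => by
      rw [← Set.mem_Icc, ← hSE]; rfl
    have hcount := northCount_translate_union (d := R.d) (n := R.u + R.v) (B := B) (C := C)
      (m := S.u + S.v)
      (fun k hk => (hmem _).2 (Or.inr ((hmemX _).2 (by omega))))
      (fun k hk => by
        have hX : ((R.d + k : ℕ) : ℤ) + 1 ∉ X := fun h => by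
          have := (hmemX _).1 h
          push_cast at this; omega
        rw [hmem, or_iff_left hX,
          show (((R.d + k : ℕ) : ℤ) + 1 - R.d) = k + 1 by push_cast; ring,
          and_iff_right (by push_cast; omega)])
      (fun k hk hkm => (hmem _).2 (Or.inr ((hmemX _).2 (by omega))))
    have hBE : B ⊆ R.labels ↔ C ⊆ S.labels ∧
        Sum.inl '' B ∪ Sum.inr '' X ⊆ Set.range R.extensionRelabel := by
      refine ⟨fun h => ⟨fun l hl => ?_,
        Set.union_subset (R.image_inl_subset_range_extensionRelabel h) hXr⟩, fun h l hl => ?_⟩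
      · rcases (hmem l).1 hl with ⟨h', -⟩ | h'
        · rw [hSE, Set.mem_Icc]; omega
        · exact h'.1
      · obtain ⟨m, hm⟩ := h.2 (Or.inl ⟨l, hl, rfl⟩)
        by_cases h : (R.d : ℤ) < m ∧ m ≤ R.d + (R.u + R.v)
        · rw [R.extensionRelabel_of_mem h] at hm
          have := Sum.inl_injective hm
          simp only [LatticeRegion.labels, Set.mem_Icc]; omega
        · rw [R.extensionRelabel_of_notMem h] at hm
          cases hm
    rw [hBE]
    have hlast : northCount C (S.u + S.v) = R.d + northCount B (R.u + R.v) + R.c := by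
      rw [hcount _ le_rfl, show min (S.u + S.v - R.d) (R.u + R.v) = R.u + R.v by omega]
      omega
    -- Here the first `d` north steps run along the upper path and the last `c` along the lower one.
    have hbounds : (R.d : ℤ) + northCount B (R.u + R.v) = (R.v : ℤ) - R.c →
        ((∀ k ≤ R.u + R.v, (R.P.point k).2 ≤ R.d + northCount B k ∧
            R.d + northCount B k ≤ (R.Q.point k).2) ↔
          ∀ k ≤ S.u + S.v, (S.P.point k).2 ≤ S.d + northCount C k ∧
            S.d + northCount C k ≤ (S.Q.point k).2) := fun hB => by
      constructor
      · intro h k hk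
        obtain ⟨h1, h2⟩ := hpt k hk
        have h3 := h (min (k - R.d) (R.u + R.v)) (by omega)
        rw [hcount k hk, h1, h2, hd]
        rcases lt_or_ge k R.d with hk1 | hk1
        · rw [show min (k - R.d) (R.u + R.v) = 0 by omega, northCount_zero, hP0, hQ0]
          omega
        rcases le_or_gt k (R.d + (R.u + R.v)) with hk2 | hk2
        · omega
        · rw [show min (k - R.d) (R.u + R.v) = R.u + R.v by omega, hPn, hQn]
          omega
      · intro h k hk
        obtain ⟨h1, h2⟩ := hpt (R.d + k) (by omega)
        have h3 := h (R.d + k) (by omega)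
        rw [hcount _ (by omega), h1, h2, hd,
          show min (R.d + k - R.d) (R.u + R.v) = k by omega] at h3
        omega
    constructor
    · rintro ⟨⟨h1, h2⟩, h3, h4⟩
      exact ⟨⟨h1, by rw [hlast, hd, hv, hc]; push_cast; omega, (hbounds h3).1 h4⟩, h2⟩
    · rintro ⟨⟨h1, h3, h4⟩, h2⟩
      have h3 : (R.d : ℤ) + northCount B (R.u + R.v) = (R.v : ℤ) - R.c := by
        rw [hlast, hd, hv, hc] at h3; push_cast at h3; omega
      exact ⟨⟨h1, h2⟩, h3, (hbounds h3).2 h4⟩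

end LatticeRegion

theorem mainTheorem6 (R : LatticeRegion) :
    ∃ h : R.minMatroid.IsQuotientOf R.maxMatroid,
      Set.MapsTo LatticePath.northLabels R.paths
        {F | (R.minMatroid.fullHiggsLift R.maxMatroid h).Feasible F} ∧
      Set.SurjOn LatticePath.northLabels R.paths
        {F | (R.minMatroid.fullHiggsLift R.maxMatroid h).Feasible F} := by
  refine ⟨R.minMatroid_isQuotientOf_maxMatroid, fun w hw => ?_, fun F hF => ?_⟩
  · exact (Matroid.isHiggsFeasible_iff _ _).2 ⟨R.northLabels_indep hw, R.northLabels_spanning hw⟩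
  · obtain ⟨hI, hS⟩ := (Matroid.isHiggsFeasible_iff _ F).1 hF
    obtain ⟨B, hB, hFB⟩ := hI.exists_isBase_superset
    obtain ⟨A, hA, hAF⟩ := hS.exists_isBase_subset
    exact R.exists_path_of_subset_of_subset hA hB hAF hFB
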